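/- **Setting.** Let $\Omega\subset\mathbb{R}$ be a (possibly unbounded) interval and let $W_2(\Omega)$ be the set of Borel probability measures carried by $\Omega$ with finite second moment. For such a measure $\nu$ let $F_\nu$ be its distribution function, $F_\nu^-(\alpha)=\inf\{x\in\mathbb R: F_\nu(x)\ge\alpha\}$ its quantile function, and put $$d_W^2(\mu,\nu)=\int_0^1\big(F_\mu^-(\alpha)-F_\nu^-(\alpha)\big)^2\,d\alpha .$$ Let $n\ge1$, let $\nu_1,\dots,\nu_n\in W_2(\Omega)$ be absolutely continuous with respect to Lebesgue measure, and let $\bar\nu$ be their Wasserstein barycenter, that is, a minimizer over $\mu\in W_2(\Omega)$ of $\frac1n\sum_{i=1}^n d_W^2(\nu_i,\mu)$. For $v\in L^2_{\bar\nu}(\Omega)$ and $\nu\in W_2(\Omega)$ put $$\exp_{\bar\nu}(v)=(\mathrm{id}+v)\#\bar\nu,\qquad \log_{\bar\nu}(\nu)=F_\nu^-\circ F_{\bar\nu}-\mathrm{id},\qquad V_{\bar\nu}(\Omega)=\log_{\bar\nu}(W_2(\Omega))\subset L^2_{\bar\nu}(\Omega).$$ A set $G\subset W_2(\Omega)$ is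 *geodesic* if $\log_{\bar\nu}(G)$ is convex, and $\dim(G)$ is then the dimension of the smallest affine subspace of $L^2_{\bar\nu}(\Omega)$ containing $\log_{\bar\nu}(G)$. For $K\ge1$ let $\mathrm{CG}_{\bar\nu,K}$ be the collection of nonempty geodesic sets $G\subset W_2(\Omega)$, closed in $(W_2(\Omega),d_W)$, with $\bar\nu\in G$ and $\dim(G)\le K$. Let $$D_W(G)=\frac1n\sum_{i=1}^n\Big(\inf_{\lambda\in G}d_W(\nu_i,\lambda)\Big)^2 .$$ A *principal geodesic subspace of dimension $K$* is a minimizer of $D_W$ over $\mathrm{CG}_{\bar\nu,K}$. For $\mathcal U=\{u_1,\dots,u_K\}\subset L^2_{\bar\nu}(\Omega)$ let $\operatorname{Sp}(\mathcal U)$ be its linear span and let $\Pi_{\operatorname{Sp}(\mathcal U)\cap V_{\bar\nu}(\Omega)}$ be the metric projection in $L^2_{\bar\nu}(\Omega)$ onto the convex set $\operatorname{Sp}(\mathcal U)\cap V_{\bar\nu}(\Omega)$ (onto its closure, if $\Omega$ is not closed and this set is not closed). **Proposition 2.2.** Let $\omega_i=\log_{\bar\nu}(\nu_i)$ for $1\le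 i\le n$, let $K\ge1$, and let $\mathcal U^*=\{u_1^*,\dots,u_K^*\}$ be an orthonormal family in $L^2_{\bar\nu}(\Omega)$ that minimizes $$\frac1n\sum_{i=1}^n\big\|\omega_i-\Pi_{\operatorname{Sp}(\mathcal U)\cap V_{\bar\nu}(\Omega)}\,\omega_i\big\|_{\bar\nu}^2$$ over all orthonormal families $\mathcal U=\{u_1,\dots,u_K\}$ in $L^2_{\bar\nu}(\Omega)$. Then $$G_{\mathcal U^*}:=\exp_{\bar\nu}\big(\operatorname{Sp}(\mathcal U^*)\cap V_{\bar\nu}(\Omega)\big)$$ is a principal geodesic subspace of dimension $K$ of $\nu_1,\dots,\nu_n$ with respect to $\bar\nu$: it belongs to $\mathrm{CG}_{\bar\nu,K}$, and $D_W(G_{\mathcal U^*})\le D_W(G)$ for every $G\in\mathrm{CG}_{\bar\nu,K}$. -/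

import Mathlib

open MeasureTheory

noncomputable section

namespace WassersteinGPCA

/-- The generalized quantile function `F_ν⁻(α) = inf {x ∈ ℝ | F_ν(x) ≥ α}` of a probability
measure on the line (meaningful for `0 < α < 1`, which is all that matters below). -/
def quantile (ν : Measure ℝ) (α : ℝ) : ℝ :=
  sInf {x : ℝ | α ≤ ProbabilityTheory.cdf ν x}

/-- The Wasserstein space `W₂(Ω)`: probability measures on the line that are carried by `Ω` and
have a finite second moment. -/
def W2 (Ω : Set ℝ) : Set (Measure ℝ) :=
  {ν | IsProbabilityMeasure ν ∧ ν Ωᶜ = 0 ∧ Integrable (fun x : ℝ => x ^ 2) ν}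

/-- The elements of `W₂(Ω)` that are absolutely continuous with respect to Lebesgue measure. -/
def W2ac (Ω : Set ℝ) : Set (Measure ℝ) :=
  {ν | ν ∈ W2 Ω ∧ ν ≪ volume}

/-- The quadratic Wasserstein distance,
`d_W(μ, ν)² = ∫₀¹ (F_μ⁻(α) - F_ν⁻(α))² dα`. -/
def dW (μ ν : Measure ℝ) : ℝ :=
  Real.sqrt (∫ α in Set.Ioo (0 : ℝ) 1, (quantile μ α - quantile ν α) ^ 2)

/-- `d_W(ν, G) = inf_{η ∈ G} d_W(ν, η)`. -/
def dWSet (ν : Measure ℝ) (G : Set (Measure ℝ)) : ℝ :=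
  ⨅ η : G, dW ν η

/-- `D_W(G) = (1/n) ∑ i, d_W(ν_i, G)²`. -/
def DW {n : ℕ} (ν : Fin n → Measure ℝ) (G : Set (Measure ℝ)) : ℝ :=
  (1 / (n : ℝ)) * ∑ i, dWSet (ν i) G ^ 2

/-- `m` is a Wasserstein barycenter (Fréchet mean) of `ν_1, …, ν_n` in `W₂(Ω)`. -/
def IsBarycenter (Ω : Set ℝ) {n : ℕ} (ν : Fin n → Measure ℝ) (m : Measure ℝ) : Prop :=
  m ∈ W2 Ω ∧
    IsMinOn (fun μ : Measure ℝ => (1 / (n : ℝ)) * ∑ i, dW (ν i) μ ^ 2) (W2 Ω) m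

/-- The exponential map `exp_μ(v) = (id + v) # μ`. -/
def expMap (μ : Measure ℝ) (v : Lp ℝ 2 μ) : Measure ℝ :=
  μ.map (fun x => x + v x)

open Classical in
/-- The logarithmic map `log_μ(ν) = F_ν⁻ ∘ F_μ - id`, as an element of `L²_μ`. When `μ` and `ν`
have finite second moments and `μ` is absolutely continuous, the function is square integrable;
the value `0` in the other case is a convention. -/
def logMap (μ ν : Measure ℝ) : Lp ℝ 2 μ :=
  if h : MemLp (fun x => quantile ν (ProbabilityTheory.cdf μ x) - x) 2 μ then h.toLp _ else 0

/-- `V_μ(Ω) = log_μ(W₂(Ω))`. -/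
def V (Ω : Set ℝ) (μ : Measure ℝ) : Set (Lp ℝ 2 μ) :=
  logMap μ '' W2 Ω

/-- `G` is closed as a subset of the metric space `(W₂(Ω), d_W)`. -/
def IsClosedInW2 (Ω : Set ℝ) (G : Set (Measure ℝ)) : Prop :=
  ∀ μ ∈ W2 Ω, (∀ ε > 0, ∃ η ∈ G, dW μ η < ε) → μ ∈ G

/-- `G` is a geodesic set (with respect to the reference measure `μ`): its image under `log_μ` is
convex. -/
def IsGeodesicSet (μ : Measure ℝ) (G : Set (Measure ℝ)) : Prop :=
  Convex ℝ (logMap μ '' G)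

/-- The dimension of a geodesic set: the (possibly infinite) dimension of the smallest affine
subspace of `L²_μ` that contains `log_μ(G)`. -/
def geodesicDim (μ : Measure ℝ) (G : Set (Measure ℝ)) : Cardinal :=
  Module.rank ℝ (affineSpan ℝ (logMap μ '' G)).direction

/-- `CG_{μ,K}(W)`: the nonempty closed geodesic subsets of `W₂(Ω)` of dimension at most `K` that
contain the reference measure `μ`. -/
def CG (Ω : Set ℝ) (μ : Measure ℝ) (K : ℕ) : Set (Set (Measure ℝ)) :=
  {G | G ⊆ W2 Ω ∧ G.Nonempty ∧ IsClosedInW2 Ω G ∧ μ ∈ G ∧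
    IsGeodesicSet μ G ∧ geodesicDim μ G ≤ (K : Cardinal)}

/-- `G` is a principal geodesic subspace of dimension `K` of `ν_1, …, ν_n` with respect to `μ`:
a minimizer of `D_W` over `CG_{μ,K}(W)`. -/
def IsPGS (Ω : Set ℝ) {n : ℕ} (ν : Fin n → Measure ℝ) (μ : Measure ℝ) (K : ℕ)
    (G : Set (Measure ℝ)) : Prop :=
  G ∈ CG Ω μ K ∧ IsMinOn (DW ν) (CG Ω μ K) G

/-- The projection `Π_C v` of `v` onto the closed convex set `C`: the point of `C` nearest to `v`.
The closure changes nothing for closed `C`. The sets projected onto below are closed when the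
interval `Ω` is; for other intervals the closure guarantees that the projection exists. -/
def proj {H : Type*} [NormedAddCommGroup H] (C : Set H) (v : H) : H :=
  Classical.epsilon fun p => p ∈ closure C ∧ ∀ q ∈ closure C, ‖v - p‖ ≤ ‖v - q‖

/-- `Sp(𝓤) ∩ V_μ(Ω)` for a family `𝓤` of `K` elements of `L²_μ`. -/
def spanV (Ω : Set ℝ) (μ : Measure ℝ) {K : ℕ} (U : Fin K → Lp ℝ 2 μ) : Set (Lp ℝ 2 μ) :=
  (Submodule.span ℝ (Set.range U) : Set (Lp ℝ 2 μ)) ∩ V Ω μ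

/-- The objective `(1/n) ∑ i, ‖ω_i - Π_{Sp(𝓤) ∩ V_μ(Ω)} ω_i‖²` with `ω_i = log_μ(ν_i)`. -/
def objective (Ω : Set ℝ) {n : ℕ} (ν : Fin n → Measure ℝ) (μ : Measure ℝ) {K : ℕ}
    (U : Fin K → Lp ℝ 2 μ) : ℝ :=
  (1 / (n : ℝ)) * ∑ i, ‖logMap μ (ν i) - proj (spanV Ω μ U) (logMap μ (ν i))‖ ^ 2

end WassersteinGPCA

end

/-!
The logarithmic map at the barycenter `m` turns the problem into one about convex sets in the
Hilbert space `L²_m`.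

A probability measure on the line is the law of its quantile function under the uniform
distribution on `(0, 1)` (`map_quantile`), and every nondecreasing square integrable function with
values in `Ω` is the quantile function of an element of `W₂(Ω)` (`exists_quantile_ae_eq`). Hence
the quantile function of the barycenter is the mean of the quantile functions of the `ν i`
(`quantile_barycenter`). Those are strictly increasing because the `ν i` have no atoms, so the
quantile function of `m` is strictly increasing too, and the distribution function of `m`
transports `m` to the uniform distribution (`measurePreserving_cdf`).

Therefore `log_m` is an isometry from `W₂(Ω)` onto the convex set `V_m(Ω)`, inverted by `exp_m`
(`norm_logMap_sub`, `expMap_logMap`, `convex_V`). It follows that `exp_m (Sp(𝓤) ∩ V_m(Ω))` is an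
admissible set with logarithmic image `Sp(𝓤) ∩ V_m(Ω)`, and `D_W` of it is the objective at `𝓤`.
Conversely, the logarithmic image of any admissible `G` contains `0 = log_m m` and spans a linear
subspace of dimension at most `K`, so that it lies in `Sp(𝓤') ∩ V_m(Ω)` for some orthonormal `𝓤'`
with `K` elements (`exists_logMap_image_subset_spanV`); enlarging a set decreases distances to it,
so `D_W(G)` is at least the objective at `𝓤'`.
-/

noncomputable section

namespace WassersteinGPCA

open Set Filter ProbabilityTheory
open scoped Topology

/-! ### Quantile functions -/

/-- The uniform distribution on `(0, 1)`. -/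
def unif : Measure ℝ := volume.restrict (Ioo 0 1)

instance : IsProbabilityMeasure unif := ⟨by simp [unif]⟩

lemma ae_unif_mem : ∀ᵐ α ∂unif, α ∈ Ioo (0 : ℝ) 1 := ae_restrict_mem measurableSet_Ioo

/-- The Galois connection between quantile function and distribution function. -/
lemma quantile_le_iff (ν : Measure ℝ) {α : ℝ} (hα : α ∈ Ioo (0 : ℝ) 1) (x : ℝ) :
    quantile ν α ≤ x ↔ α ≤ cdf ν x := by
  set S := {x : ℝ | α ≤ cdf ν x} with hS
  have hne : S.Nonempty := by
    obtain ⟨y, hy⟩ := ((tendsto_cdf_atTop ν).eventually (lt_mem_nhds hα.2)).exists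
    exact ⟨y, le_of_lt hy⟩
  have hbdd : BddBelow S := by
    obtain ⟨y, hy⟩ := ((tendsto_cdf_atBot ν).eventually (gt_mem_nhds hα.1)).exists
    refine ⟨y, fun z hz => ?_⟩
    by_contra! hlt
    exact absurd (hz.trans (monotone_cdf ν hlt.le)) (not_le.2 hy)
  constructor
  · intro h
    -- every point to the right of the infimum lies in `S`; then use right continuity
    have hev : ∀ᶠ y in 𝓝[>] x, α ≤ cdf ν y := by
      filter_upwards [self_mem_nhdsWithin] with y hy
      obtain ⟨z, hz, hzy⟩ := exists_lt_of_csInf_lt hne (lt_of_le_of_lt h hy)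
      exact le_trans hz (monotone_cdf ν hzy.le)
    exact ge_of_tendsto (((cdf ν).right_continuous x).mono Ioi_subset_Ici_self) hev
  · intro h
    exact csInf_le hbdd h

lemma monotoneOn_quantile (ν : Measure ℝ) : MonotoneOn (quantile ν) (Ioo 0 1) := by
  intro α hα β hβ h
  rw [quantile_le_iff ν hα]
  exact h.trans ((quantile_le_iff ν hβ _).1 le_rfl)

lemma aemeasurable_of_monotoneOn {g : ℝ → ℝ} (hg : MonotoneOn g (Ioo 0 1)) :
    AEMeasurable g unif :=
  aemeasurable_restrict_of_monotoneOn measurableSet_Ioo hg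

lemma aemeasurable_quantile (ν : Measure ℝ) : AEMeasurable (quantile ν) unif :=
  aemeasurable_of_monotoneOn (monotoneOn_quantile ν)

/-- Inverse transform sampling: the quantile function of `ν` has law `ν` under the uniform
distribution. -/
lemma map_quantile (ν : Measure ℝ) [IsProbabilityMeasure ν] : unif.map (quantile ν) = ν := by
  have : IsProbabilityMeasure (unif.map (quantile ν)) :=
    Measure.isProbabilityMeasure_map (aemeasurable_quantile ν)
  refine Measure.ext_of_Iic _ _ fun x => ?_
  rw [Measure.map_apply_of_aemeasurable (aemeasurable_quantile ν) measurableSet_Iic,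
    ← ofReal_cdf ν x]
  have h1 : quantile ν ⁻¹' Iic x =ᵐ[unif] Iic (cdf ν x) := by
    filter_upwards [ae_unif_mem] with α hα
    exact propext (quantile_le_iff ν hα x)
  rw [measure_congr h1, unif, Measure.restrict_congr_set Ioo_ae_eq_Ioc,
    Measure.restrict_apply measurableSet_Iic]
  have h2 : Iic (cdf ν x) ∩ Ioc 0 1 = Ioc 0 (cdf ν x) := by
    ext y
    have := cdf_le_one ν x
    simp only [mem_inter_iff, mem_Iic, mem_Ioc]
    constructor
    · rintro ⟨a, b, c⟩; exact ⟨b, a⟩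
    · rintro ⟨a, b⟩; exact ⟨b, a, b.trans this⟩
  rw [h2, Real.volume_Ioc, sub_zero]

/-- For a nondecreasing `g` on `(0, 1)` the quantile function of its law under the uniform
distribution is `g` again. It is at most `g` because `P(g ≤ g α) ≥ α`; since both functions have
the same law, they have the same integral and hence agree almost everywhere. -/
lemma quantile_map_ae_eq {g : ℝ → ℝ} (hg : MonotoneOn g (Ioo 0 1)) (hint : Integrable g unif) :
    quantile (unif.map g) =ᵐ[unif] g := by
  have hgm := aemeasurable_of_monotoneOn hg
  have hprob : IsProbabilityMeasure (unif.map g) := Measure.isProbabilityMeasure_map hgm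
  have hlaw : unif.map (quantile (unif.map g)) = unif.map g := map_quantile _
  have hle : quantile (unif.map g) ≤ᵐ[unif] g := by
    filter_upwards [ae_unif_mem] with α hα
    rw [quantile_le_iff _ hα, ← ENNReal.ofReal_le_ofReal_iff (cdf_nonneg _ _), ofReal_cdf,
      Measure.map_apply_of_aemeasurable hgm measurableSet_Iic]
    calc ENNReal.ofReal α = unif (Ioc 0 α) := by
          rw [unif, Measure.restrict_congr_set Ioo_ae_eq_Ioc,
            Measure.restrict_apply measurableSet_Ioc,
            inter_eq_left.2 (Ioc_subset_Ioc_right hα.2.le), Real.volume_Ioc, sub_zero]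
      _ ≤ unif (g ⁻¹' Iic (g α)) := by
          refine measure_mono_ae ?_
          filter_upwards [ae_unif_mem] with β hβ hβα
          exact hg hβ hα hβα.2
  have hid : AEStronglyMeasurable (fun x : ℝ => x) (unif.map g) :=
    measurable_id.aestronglyMeasurable
  have hQ := aemeasurable_quantile (unif.map g)
  have hint' : Integrable (quantile (unif.map g)) unif := by
    have h1 : Integrable (fun x : ℝ => x) (unif.map g) := (integrable_map_measure hid hgm).2 hint
    rw [← hlaw] at h1 hid
    exact (integrable_map_measure hid hQ).1 h1
  refine (integral_eq_iff_of_ae_le hint' hint hle).1 ?_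
  rw [← integral_map hgm hid]
  conv_rhs => rw [← hlaw]
  exact (integral_map hQ (by rw [hlaw]; exact hid)).symm

lemma memLp_quantile {Ω : Set ℝ} {ν : Measure ℝ} (hν : ν ∈ W2 Ω) : MemLp (quantile ν) 2 unif := by
  have := hν.1
  have h : MemLp (fun x : ℝ => x) 2 (unif.map (quantile ν)) := by
    rw [map_quantile]
    exact (memLp_two_iff_integrable_sq measurable_id.aestronglyMeasurable).2 hν.2.2
  exact (memLp_map_measure_iff measurable_id.aestronglyMeasurable (aemeasurable_quantile ν)).1 h

lemma ae_quantile_mem {Ω : Set ℝ} {ν : Measure ℝ} (hν : ν ∈ W2 Ω) :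
    ∀ᵐ α ∂unif, quantile ν α ∈ Ω := by
  have := hν.1
  refine ae_of_ae_map (p := fun x => x ∈ Ω) (aemeasurable_quantile ν) ?_
  rw [map_quantile]
  exact hν.2.1

/-- Every nondecreasing square integrable function on `(0, 1)` with values in `Ω` is the quantile
function of an element of `W₂(Ω)`. -/
lemma exists_quantile_ae_eq {Ω : Set ℝ} (hΩ : Ω.OrdConnected) {g : ℝ → ℝ}
    (hg : MonotoneOn g (Ioo 0 1)) (hL : MemLp g 2 unif) (hmem : ∀ᵐ α ∂unif, g α ∈ Ω) :
    ∃ μ ∈ W2 Ω, quantile μ =ᵐ[unif] g := by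
  have hgm := aemeasurable_of_monotoneOn hg
  refine ⟨unif.map g, ⟨Measure.isProbabilityMeasure_map hgm, ?_, ?_⟩,
    quantile_map_ae_eq hg (hL.integrable one_le_two)⟩
  · rw [Measure.map_apply_of_aemeasurable hgm hΩ.measurableSet.compl]
    exact hmem
  · exact (integrable_map_measure (by fun_prop) hgm).2
      ((memLp_two_iff_integrable_sq hL.1).1 hL)

/-! ### The barycenter -/

/-- The quantile function of an absolutely continuous measure, which has no atoms, is strictly increasing: on an interval where
it is constant it would charge that constant. -/
lemma strictMonoOn_quantile {ν : Measure ℝ} [IsProbabilityMeasure ν] (h : ν ≪ volume) :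
    StrictMonoOn (quantile ν) (Ioo 0 1) := by
  intro α hα β hβ hlt
  refine lt_of_le_of_ne (monotoneOn_quantile ν hα hβ hlt.le) fun heq => ?_
  have h0 : ν {quantile ν α} = 0 := h Real.volume_singleton
  rw [← map_quantile ν,
    Measure.map_apply_of_aemeasurable (aemeasurable_quantile ν) (measurableSet_singleton _),
    map_quantile ν] at h0
  have h1 : Ioo α β ⊆ quantile ν ⁻¹' {quantile ν α} := fun γ hγ => by
    have hγ' : γ ∈ Ioo (0 : ℝ) 1 := ⟨hα.1.trans hγ.1, hγ.2.trans hβ.2⟩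
    exact le_antisymm (heq ▸ monotoneOn_quantile ν hγ' hβ hγ.2.le)
      (monotoneOn_quantile ν hα hγ' hγ.1.le)
  have h2 : unif (Ioo α β) = 0 := measure_mono_null h1 h0
  rw [unif, Measure.restrict_apply measurableSet_Ioo,
    inter_eq_left.2 (Ioo_subset_Ioo hα.1.le hβ.2.le), Real.volume_Ioo, ENNReal.ofReal_eq_zero] at h2
  linarith

/-- Almost everywhere equality with a strictly increasing function makes a nondecreasing function
strictly increasing everywhere on `(0, 1)`: any `α < β` are separated by two points of equality. -/
lemma strictMonoOn_of_ae_eq {f g : ℝ → ℝ} (hf : MonotoneOn f (Ioo 0 1))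
    (hg : StrictMonoOn g (Ioo 0 1)) (h : f =ᵐ[unif] g) : StrictMonoOn f (Ioo 0 1) := by
  have key : ∀ a b : ℝ, a ∈ Ioo (0 : ℝ) 1 → b ∈ Ioo (0 : ℝ) 1 → a < b →
      ∃ c ∈ Ioo a b, f c = g c := by
    intro a b ha hb hab
    by_contra! hne
    have h2 : unif (Ioo a b) = 0 := measure_mono_null (fun c hc => hne c hc) h
    rw [unif, Measure.restrict_apply measurableSet_Ioo,
      inter_eq_left.2 (Ioo_subset_Ioo ha.1.le hb.2.le), Real.volume_Ioo,
      ENNReal.ofReal_eq_zero] at h2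
    linarith
  intro α hα β hβ hlt
  obtain ⟨c, hc, hfc⟩ := key α β hα hβ hlt
  have hc' : c ∈ Ioo (0 : ℝ) 1 := ⟨hα.1.trans hc.1, hc.2.trans hβ.2⟩
  obtain ⟨d, hd, hfd⟩ := key c β hc' hβ hc.2
  have hd' : d ∈ Ioo (0 : ℝ) 1 := ⟨hc'.1.trans hd.1, hd.2.trans hβ.2⟩
  calc f α ≤ f c := hf hα hc' hc.1.le
    _ = g c := hfc
    _ < g d := hg hc' hd' hd.1
    _ = f d := hfd.symm
    _ ≤ f β := hf hd' hβ hd.2.le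

lemma dW_nonneg (μ ν : Measure ℝ) : 0 ≤ dW μ ν := Real.sqrt_nonneg _

lemma dW_sq (μ ν : Measure ℝ) : dW μ ν ^ 2 = ∫ α, (quantile μ α - quantile ν α) ^ 2 ∂unif :=
  Real.sq_sqrt (integral_nonneg fun _ => sq_nonneg _)

lemma integrable_sq_quantile_sub {f g : ℝ → ℝ} (hf : MemLp f 2 unif) (hg : MemLp g 2 unif) :
    Integrable (fun α => (f α - g α) ^ 2) unif :=
  (hf.sub hg).integrable_sq

/-- The pointwise mean of the quantile functions. -/
def meanQuantile {n : ℕ} (ν : Fin n → Measure ℝ) (α : ℝ) : ℝ :=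
  (n : ℝ)⁻¹ * ∑ i, quantile (ν i) α

lemma memLp_meanQuantile {Ω : Set ℝ} {n : ℕ} {ν : Fin n → Measure ℝ} (hν : ∀ i, ν i ∈ W2 Ω) :
    MemLp (meanQuantile ν) 2 unif :=
  (memLp_finsetSum _ fun i _ => memLp_quantile (hν i)).const_mul _

lemma sum_sq_sub_eq {n : ℕ} (hn : 1 ≤ n) (q : Fin n → ℝ) (y : ℝ) :
    ∑ i, (q i - y) ^ 2 = ∑ i, (q i - (n : ℝ)⁻¹ * ∑ j, q j) ^ 2
      + n * (y - (n : ℝ)⁻¹ * ∑ j, q j) ^ 2 := by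
  have hn0 : (n : ℝ) ≠ 0 := by positivity
  simp only [sub_sq, Finset.sum_add_distrib, Finset.sum_sub_distrib, ← Finset.sum_mul,
    ← Finset.mul_sum, Finset.sum_const, Finset.card_univ, Fintype.card_fin, nsmul_eq_mul]
  field_simp
  ring

/-- The quantile function of the barycenter is the mean of the quantile functions: the mean is
itself the quantile function of an element of `W₂(Ω)`, and it minimizes the sum of squares
pointwise. -/
lemma quantile_barycenter {Ω : Set ℝ} (hΩ : Ω.OrdConnected) {n : ℕ} (hn : 1 ≤ n)
    {ν : Fin n → Measure ℝ} (hν : ∀ i, ν i ∈ W2 Ω) {m : Measure ℝ} (hm : IsBarycenter Ω ν m) :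
    quantile m =ᵐ[unif] meanQuantile ν := by
  have hn0 : (0 : ℝ) < n := by exact_mod_cast hn
  have hsum : ∑ _i : Fin n, (n : ℝ)⁻¹ = 1 := by
    simp [hn0.ne']
  obtain ⟨μ, hμ, hμq⟩ : ∃ μ ∈ W2 Ω, quantile μ =ᵐ[unif] meanQuantile ν := by
    refine exists_quantile_ae_eq hΩ ?_ (memLp_meanQuantile hν) ?_
    · intro α hα β hβ h
      refine mul_le_mul_of_nonneg_left ?_ (by positivity)
      exact Finset.sum_le_sum fun i _ => monotoneOn_quantile (ν i) hα hβ h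
    · filter_upwards [ae_all_iff.2 fun i => ae_quantile_mem (hν i)] with α hα
      have := hΩ.convex (𝕜 := ℝ) |>.sum_mem (t := Finset.univ) (w := fun _ : Fin n => (n : ℝ)⁻¹)
        (fun _ _ => by positivity) hsum (fun i _ => hα i)
      simpa [meanQuantile, Finset.mul_sum] using this
  have hle : ∑ i, dW (ν i) m ^ 2 ≤ ∑ i, dW (ν i) μ ^ 2 :=
    le_of_mul_le_mul_left (hm.2 hμ) (by positivity)
  have hexp : ∀ η ∈ W2 Ω, ∑ i, dW (ν i) η ^ 2 =
      ∑ i, (∫ α, (quantile (ν i) α - meanQuantile ν α) ^ 2 ∂unif)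
        + n * ∫ α, (quantile η α - meanQuantile ν α) ^ 2 ∂unif := by
    intro η hη
    simp only [dW_sq]
    have hM := memLp_meanQuantile hν
    rw [← integral_finsetSum _ fun i _ =>
        integrable_sq_quantile_sub (memLp_quantile (hν i)) (memLp_quantile hη),
      ← integral_finsetSum _ fun i _ => integrable_sq_quantile_sub (memLp_quantile (hν i)) hM,
      ← integral_const_mul, ← integral_add
        (integrable_finsetSum _ fun i _ => integrable_sq_quantile_sub (memLp_quantile (hν i)) hM)
        ((integrable_sq_quantile_sub (memLp_quantile hη) hM).const_mul _)]
    exact integral_congr_ae (.of_forall fun α => sum_sq_sub_eq hn _ _)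
  have hzero : ∫ α, (quantile μ α - meanQuantile ν α) ^ 2 ∂unif = 0 := by
    refine (integral_congr_ae ?_).trans (integral_zero ℝ ℝ)
    filter_upwards [hμq] with α hα
    simp [hα]
  -- the barycenter does at least as well as `μ`, which attains the pointwise minimum
  rw [hexp m hm.1, hexp μ hμ, hzero, mul_zero, add_le_add_iff_left] at hle
  have hz : ∫ α, (quantile m α - meanQuantile ν α) ^ 2 ∂unif = 0 :=
    le_antisymm (nonpos_of_mul_nonpos_right hle hn0) (integral_nonneg fun _ => sq_nonneg _)
  rw [integral_eq_zero_iff_of_nonneg (fun _ => sq_nonneg _)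
    (integrable_sq_quantile_sub (memLp_quantile hm.1) (memLp_meanQuantile hν))] at hz
  filter_upwards [hz] with α hα
  exact sub_eq_zero.1 (pow_eq_zero_iff two_ne_zero |>.1 hα)

lemma strictMonoOn_quantile_barycenter {Ω : Set ℝ} (hΩ : Ω.OrdConnected) {n : ℕ} (hn : 1 ≤ n)
    {ν : Fin n → Measure ℝ} (hν : ∀ i, ν i ∈ W2ac Ω) {m : Measure ℝ} (hm : IsBarycenter Ω ν m) :
    StrictMonoOn (quantile m) (Ioo 0 1) := by
  refine strictMonoOn_of_ae_eq (monotoneOn_quantile m) ?_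
    (quantile_barycenter hΩ hn (fun i => (hν i).1) hm)
  have : Nonempty (Fin n) := ⟨⟨0, hn⟩⟩
  intro α hα β hβ h
  refine mul_lt_mul_of_pos_left (Finset.sum_lt_sum_of_nonempty Finset.univ_nonempty fun i _ => ?_)
    (by positivity)
  have := (hν i).1.1
  exact strictMonoOn_quantile (hν i).2 hα hβ h

/-! ### The logarithmic map -/

/-! Below, the base measure `m` is only required to have a strictly increasing quantile function;
this is the same as having no atoms, and it replaces absolute continuity. -/

section Log

variable {Ω : Set ℝ} {m : Measure ℝ}

lemma measurable_cdf (μ : Measure ℝ) : Measurable (cdf μ) := (monotone_cdf μ).measurable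

lemma cdf_quantile (hm : StrictMonoOn (quantile m) (Ioo 0 1)) {α : ℝ} (hα : α ∈ Ioo (0 : ℝ) 1) :
    cdf m (quantile m α) = α := by
  refine le_antisymm ?_ ((quantile_le_iff m hα _).1 le_rfl)
  by_contra! hlt
  obtain ⟨β, h1, h2⟩ := exists_between (lt_min hlt hα.2)
  have hβ : β ∈ Ioo (0 : ℝ) 1 := ⟨hα.1.trans h1, h2.trans_le (min_le_right _ _)⟩
  have : quantile m β ≤ quantile m α :=
    (quantile_le_iff m hβ _).2 (h2.le.trans (min_le_left _ _))
  exact absurd (hm hα hβ h1) (not_lt.2 this)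

lemma measurePreserving_cdf [IsProbabilityMeasure m]
    (hm : StrictMonoOn (quantile m) (Ioo 0 1)) : MeasurePreserving (cdf m) m unif := by
  refine ⟨measurable_cdf m, ?_⟩
  have h : unif.map (cdf m ∘ quantile m) = unif := by
    have hid : cdf m ∘ quantile m =ᵐ[unif] id := by
      filter_upwards [ae_unif_mem] with α hα using cdf_quantile hm hα
    rw [Measure.map_congr hid, Measure.map_id]
  rwa [← AEMeasurable.map_map_of_aemeasurable (measurable_cdf m).aemeasurable
    (aemeasurable_quantile m), map_quantile] at h

/-- `Q ∘ F = id` almost surely, since `m` is the law of `Q` and `F ∘ Q = id`. -/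
lemma quantile_cdf_ae [IsProbabilityMeasure m] (hm : StrictMonoOn (quantile m) (Ioo 0 1)) :
    ∀ᵐ x ∂m, quantile m (cdf m x) = x := by
  have hnull : NullMeasurableSet {x | quantile m (cdf m x) = x} (unif.map (quantile m)) := by
    rw [map_quantile]
    exact nullMeasurableSet_eq_fun ((aemeasurable_quantile m).comp_quasiMeasurePreserving
      (measurePreserving_cdf hm).quasiMeasurePreserving) aemeasurable_id
  have h : ∀ᵐ x ∂(unif.map (quantile m)), x ∈ {x | quantile m (cdf m x) = x} := by
    rw [ae_iff]
    change unif.map (quantile m) {x | quantile m (cdf m x) = x}ᶜ = 0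
    rw [Measure.map_apply₀ (aemeasurable_quantile m) hnull.compl]
    change ∀ᵐ α ∂unif, quantile m (cdf m (quantile m α)) = quantile m α
    filter_upwards [ae_unif_mem] with α hα
    rw [cdf_quantile hm hα]
  rwa [map_quantile] at h

lemma coeFn_logMap (hW : m ∈ W2 Ω) (hm : StrictMonoOn (quantile m) (Ioo 0 1)) {ν : Measure ℝ}
    (hν : ν ∈ W2 Ω) : logMap m ν =ᵐ[m] fun x => quantile ν (cdf m x) - x := by
  have := hW.1
  have h : MemLp (fun x => quantile ν (cdf m x) - x) 2 m :=
    ((memLp_quantile hν).comp_measurePreserving (measurePreserving_cdf hm)).sub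
      ((memLp_two_iff_integrable_sq measurable_id.aestronglyMeasurable).2 hW.2.2)
  rw [logMap, dif_pos h]
  exact h.coeFn_toLp

lemma logMap_self (hW : m ∈ W2 Ω) (hm : StrictMonoOn (quantile m) (Ioo 0 1)) :
    logMap m m = 0 := by
  have := hW.1
  refine Lp.ext ?_
  filter_upwards [coeFn_logMap hW hm hW, quantile_cdf_ae hm, Lp.coeFn_zero ℝ 2 m] with x h1 h2 h3
  rw [h1, h2, h3, sub_self, Pi.zero_apply]

/-- The logarithmic map is isometric, because the distribution function of the base measure
transports it to the uniform distribution. -/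
lemma norm_logMap_sub (hW : m ∈ W2 Ω) (hm : StrictMonoOn (quantile m) (Ioo 0 1))
    {μ ν : Measure ℝ} (hμ : μ ∈ W2 Ω) (hν : ν ∈ W2 Ω) :
    ‖logMap m μ - logMap m ν‖ = dW μ ν := by
  have := hW.1
  have hcdf := measurePreserving_cdf hm
  refine (sq_eq_sq₀ (norm_nonneg _) (dW_nonneg μ ν)).1 ?_
  rw [dW_sq, ← real_inner_self_eq_norm_sq, L2.inner_def]
  have h1 : ∫ x, inner ℝ ((logMap m μ - logMap m ν) x) ((logMap m μ - logMap m ν) x) ∂m =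
      ∫ x, (quantile μ (cdf m x) - quantile ν (cdf m x)) ^ 2 ∂m := by
    refine integral_congr_ae ?_
    filter_upwards [coeFn_logMap hW hm hμ, coeFn_logMap hW hm hν,
      Lp.coeFn_sub (logMap m μ) (logMap m ν)] with x h1 h2 h3
    rw [h3, Pi.sub_apply, h1, h2, real_inner_self_eq_norm_sq, Real.norm_eq_abs, sq_abs]
    ring
  have h2 := integral_map (f := fun α => (quantile μ α - quantile ν α) ^ 2)
    (measurable_cdf m).aemeasurable (by
      rw [hcdf.map_eq]
      exact (integrable_sq_quantile_sub (memLp_quantile hμ) (memLp_quantile hν)).1)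
  rw [hcdf.map_eq] at h2
  rw [h1, h2]

/-- The exponential map is a left inverse of the logarithmic map on `W₂(Ω)`: it pushes `m` forward
by `F_ν⁻ ∘ F_m`, and `F_m` sends `m` to the uniform distribution. -/
lemma expMap_logMap (hW : m ∈ W2 Ω) (hm : StrictMonoOn (quantile m) (Ioo 0 1))
    {ν : Measure ℝ} (hν : ν ∈ W2 Ω) : expMap m (logMap m ν) = ν := by
  have := hW.1
  have := hν.1
  have hcdf := measurePreserving_cdf hm
  have h : (fun x => x + logMap m ν x) =ᵐ[m] quantile ν ∘ cdf m := by
    filter_upwards [coeFn_logMap hW hm hν] with x hx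
    rw [hx, Function.comp_apply, add_sub_cancel]
  rw [expMap, Measure.map_congr h, ← AEMeasurable.map_map_of_aemeasurable (by
    rw [hcdf.map_eq]; exact aemeasurable_quantile ν) (measurable_cdf m).aemeasurable,
    hcdf.map_eq, map_quantile]

/-- Convex combinations of quantile functions are quantile functions. -/
lemma convex_V (hΩ : Ω.OrdConnected) (hW : m ∈ W2 Ω)
    (hm : StrictMonoOn (quantile m) (Ioo 0 1)) : Convex ℝ (V Ω m) := by
  have := hW.1
  rintro _ ⟨μ, hμ, rfl⟩ _ ⟨ν, hν, rfl⟩ a b ha hb hab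
  obtain ⟨η, hη, hq⟩ : ∃ η ∈ W2 Ω,
      quantile η =ᵐ[unif] fun α => a * quantile μ α + b * quantile ν α := by
    refine exists_quantile_ae_eq hΩ ?_
      (((memLp_quantile hμ).const_mul a).add ((memLp_quantile hν).const_mul b)) ?_
    · intro α hα β hβ h
      exact add_le_add
        (mul_le_mul_of_nonneg_left (monotoneOn_quantile μ hα hβ h) ha)
        (mul_le_mul_of_nonneg_left (monotoneOn_quantile ν hα hβ h) hb)
    · filter_upwards [ae_quantile_mem hμ, ae_quantile_mem hν] with α h1 h2
      exact hΩ.convex (𝕜 := ℝ) h1 h2 ha hb hab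
  refine ⟨η, hη, Lp.ext ?_⟩
  have hq' := (measurePreserving_cdf hm).quasiMeasurePreserving.ae_eq_comp hq
  filter_upwards [hq', coeFn_logMap hW hm hη, coeFn_logMap hW hm hμ, coeFn_logMap hW hm hν,
    Lp.coeFn_add (a • logMap m μ) (b • logMap m ν), Lp.coeFn_smul a (logMap m μ),
    Lp.coeFn_smul b (logMap m ν)] with x h1 h2 h3 h4 h5 h6 h7
  simp only [Function.comp_apply] at h1
  rw [h2, h1, h5, Pi.add_apply, h6, h7, Pi.smul_apply, Pi.smul_apply, h3, h4, smul_eq_mul,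
    smul_eq_mul]
  linear_combination x * hab

/-- By isometry, distances to sets of measures are distances to their logarithmic images. -/
lemma dWSet_eq_infDist (hW : m ∈ W2 Ω) (hm : StrictMonoOn (quantile m) (Ioo 0 1))
    {ν : Measure ℝ} (hν : ν ∈ W2 Ω) {G : Set (Measure ℝ)} (hG : G ⊆ W2 Ω) :
    dWSet ν G = Metric.infDist (logMap m ν) (logMap m '' G) := by
  rw [Metric.infDist_eq_iInf, dWSet, ← sInf_range, ← sInf_range]
  congr 1
  ext r
  constructor
  · rintro ⟨η, rfl⟩
    exact ⟨⟨_, η, η.2, rfl⟩, (dist_eq_norm _ _).trans (norm_logMap_sub hW hm hν (hG η.2))⟩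
  · rintro ⟨⟨_, η, hη, rfl⟩, rfl⟩
    exact ⟨⟨η, hη⟩, ((dist_eq_norm _ _).trans (norm_logMap_sub hW hm hν (hG hη))).symm⟩

end Log

/-! ### Projections and subspaces of prescribed dimension -/

/-- The metric projection onto the closure of a nonempty convex set of a Hilbert space exists, so
the choice made in `proj` is a genuine one and realizes the distance. -/
lemma norm_sub_proj {H : Type*} [NormedAddCommGroup H] [InnerProductSpace ℝ H] [CompleteSpace H]
    {C : Set H} (hne : C.Nonempty) (hC : Convex ℝ C) (v : H) :
    ‖v - proj C v‖ = Metric.infDist v C := by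
  have hinf : ⨅ w : closure C, ‖v - w‖ = Metric.infDist v C := by
    rw [← Metric.infDist_closure, Metric.infDist_eq_iInf]
    simp only [dist_eq_norm]
  obtain ⟨p, hp, hpv⟩ := exists_norm_eq_iInf_of_complete_convex hne.closure
    isClosed_closure.isComplete hC.closure v
  have hex : ∃ p, p ∈ closure C ∧ ∀ q ∈ closure C, ‖v - p‖ ≤ ‖v - q‖ := by
    refine ⟨p, hp, fun q hq => ?_⟩
    rw [hpv, hinf, ← Metric.infDist_closure, ← dist_eq_norm]
    exact Metric.infDist_le_dist_of_mem hq
  have hs : proj C v ∈ closure C ∧ ∀ q ∈ closure C, ‖v - proj C v‖ ≤ ‖v - q‖ :=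
    Classical.epsilon_spec hex
  refine le_antisymm ((hs.2 p hp).trans_eq (hpv.trans hinf)) ?_
  rw [← Metric.infDist_closure, ← dist_eq_norm]
  exact Metric.infDist_le_dist_of_mem hs.1

/-- A subspace can be enlarged, by vectors of `S`, to one of the dimension of `S`. -/
lemma exists_finrank_eq_of_le {k E : Type*} [Field k] [AddCommGroup E] [Module k E]
    (W S : Submodule k E) [FiniteDimensional k W] [FiniteDimensional k S]
    (h : Module.finrank k W ≤ Module.finrank k S) :
    ∃ W' : Submodule k E, W ≤ W' ∧ FiniteDimensional k W' ∧
      Module.finrank k W' = Module.finrank k S := by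
  suffices ∀ d, Module.finrank k W ≤ d → d ≤ Module.finrank k S →
      ∃ W' : Submodule k E, W ≤ W' ∧ FiniteDimensional k W' ∧ Module.finrank k W' = d from
    this _ h le_rfl
  intro d hd
  induction d, hd using Nat.le_induction with
  | base => exact fun _ => ⟨W, le_rfl, inferInstance, rfl⟩
  | succ d _ ih =>
    intro hdS
    obtain ⟨W', hle, hfin, hrank⟩ := ih (by omega)
    have hnot : ¬ S ≤ W' := fun hS => by
      have := Submodule.finrank_mono hS
      omega
    obtain ⟨x, -, hx⟩ := SetLike.not_le_iff_exists.1 hnot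
    refine ⟨W' ⊔ Submodule.span k {x}, hle.trans le_sup_left, inferInstance, ?_⟩
    have hx0 : x ≠ 0 := fun h0 => hx (h0 ▸ W'.zero_mem)
    have hbot : W' ⊓ Submodule.span k {x} = ⊥ :=
      (Submodule.disjoint_span_singleton' hx0).2 hx |>.eq_bot
    have := Submodule.finrank_sup_add_finrank_inf_eq W' (Submodule.span k {x})
    rw [hbot, finrank_bot, finrank_span_singleton hx0] at this
    omega

/-- A subspace of dimension at most `K` lies in the span of an orthonormal family of exactly `K`
vectors, provided that the space contains such a family at all. -/
lemma exists_orthonormal_le_span {E : Type*} [NormedAddCommGroup E] [InnerProductSpace ℝ E]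
    {K : ℕ} {U : Fin K → E} (hU : Orthonormal ℝ U) (W : Submodule ℝ E)
    (hW : Module.rank ℝ W ≤ K) :
    ∃ U' : Fin K → E, Orthonormal ℝ U' ∧ W ≤ Submodule.span ℝ (range U') := by
  have hWfin : FiniteDimensional ℝ W :=
    Module.rank_lt_aleph0_iff.1 (hW.trans_lt Cardinal.natCast_lt_aleph0)
  have hS : Module.finrank ℝ (Submodule.span ℝ (range U)) = K := by
    simpa using finrank_span_eq_card hU.linearIndependent
  have hSfin : FiniteDimensional ℝ (Submodule.span ℝ (range U)) :=
    FiniteDimensional.span_of_finite ℝ (finite_range U)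
  obtain ⟨W', hle, hfin, hrank⟩ := exists_finrank_eq_of_le W (Submodule.span ℝ (range U))
    ((Module.finrank_le_of_rank_le hW).trans hS.ge)
  let b := (stdOrthonormalBasis ℝ W').reindex (finCongr (hrank.trans hS))
  refine ⟨fun i => b i, b.orthonormal.comp_linearIsometry W'.subtypeₗᵢ, hle.trans ?_⟩
  have h := congrArg (Submodule.map W'.subtype) b.toBasis.span_eq
  rw [Submodule.map_span, Submodule.map_subtype_top, ← range_comp] at h
  refine h.ge.trans (Submodule.span_mono ?_)
  rintro _ ⟨i, rfl⟩
  exact ⟨i, by simp⟩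

/-! ### Principal geodesic subspaces -/

section PGS

variable {Ω : Set ℝ} {m : Measure ℝ} {K : ℕ}

lemma image_expMap_spanV_subset (hW : m ∈ W2 Ω) (hm : StrictMonoOn (quantile m) (Ioo 0 1))
    (U : Fin K → Lp ℝ 2 m) : expMap m '' spanV Ω m U ⊆ W2 Ω := by
  rintro _ ⟨_, ⟨-, ν, hν, rfl⟩, rfl⟩
  rwa [expMap_logMap hW hm hν]

lemma logMap_image_expMap_spanV (hW : m ∈ W2 Ω) (hm : StrictMonoOn (quantile m) (Ioo 0 1))
    (U : Fin K → Lp ℝ 2 m) : logMap m '' (expMap m '' spanV Ω m U) = spanV Ω m U := by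
  rw [image_image]
  refine (image_congr ?_).trans (image_id _)
  rintro _ ⟨-, ν, hν, rfl⟩
  rw [expMap_logMap hW hm hν, id]

lemma zero_mem_spanV (hW : m ∈ W2 Ω) (hm : StrictMonoOn (quantile m) (Ioo 0 1))
    (U : Fin K → Lp ℝ 2 m) : 0 ∈ spanV Ω m U :=
  ⟨Submodule.zero_mem _, m, hW, logMap_self hW hm⟩

lemma convex_spanV (hΩ : Ω.OrdConnected) (hW : m ∈ W2 Ω)
    (hm : StrictMonoOn (quantile m) (Ioo 0 1)) (U : Fin K → Lp ℝ 2 m) :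
    Convex ℝ (spanV Ω m U) :=
  (Submodule.convex _).inter (convex_V hΩ hW hm)

/-- Closedness holds because the span is finite-dimensional, hence closed, and the logarithmic map
is isometric. -/
lemma image_expMap_spanV_mem_CG (hΩ : Ω.OrdConnected) (hW : m ∈ W2 Ω)
    (hm : StrictMonoOn (quantile m) (Ioo 0 1)) (U : Fin K → Lp ℝ 2 m) :
    expMap m '' spanV Ω m U ∈ CG Ω m K := by
  have hlog := logMap_image_expMap_spanV hW hm U
  have hsub := image_expMap_spanV_subset hW hm U
  have hmem : m ∈ expMap m '' spanV Ω m U :=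
    ⟨0, zero_mem_spanV hW hm U, by rw [← logMap_self hW hm, expMap_logMap hW hm hW]⟩
  refine ⟨hsub, ⟨m, hmem⟩, ?_, hmem, ?_, ?_⟩
  · intro μ hμ happ
    refine ⟨logMap m μ, ⟨?_, μ, hμ, rfl⟩, expMap_logMap hW hm hμ⟩
    have hfin : FiniteDimensional ℝ (Submodule.span ℝ (range U)) :=
      FiniteDimensional.span_of_finite ℝ (finite_range U)
    have hclosed : IsClosed (Submodule.span ℝ (range U) : Set (Lp ℝ 2 m)) :=
      Submodule.closed_of_finiteDimensional _
    rw [← hclosed.closure_eq, Metric.mem_closure_iff]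
    intro ε hε
    obtain ⟨η, hη, hlt⟩ := happ ε hε
    refine ⟨logMap m η, (hlog ▸ mem_image_of_mem (logMap m) hη : _ ∈ spanV Ω m U).1, ?_⟩
    rwa [dist_eq_norm, norm_logMap_sub hW hm hμ (hsub hη)]
  · rw [IsGeodesicSet, hlog]
    exact convex_spanV hΩ hW hm U
  · rw [geodesicDim, hlog, direction_affineSpan]
    have hle : vectorSpan ℝ (spanV Ω m U) ≤ Submodule.span ℝ (range U) := by
      refine Submodule.span_le.2 ?_
      rintro _ ⟨x, hx, y, hy, rfl⟩
      exact Submodule.sub_mem _ hx.1 hy.1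
    refine (Submodule.rank_mono hle).trans ((rank_span_le _).trans ?_)
    exact Cardinal.mk_range_le.trans (by simp)

/-- Every competitor `G` is contained, on the logarithmic side, in some `Sp(𝓤) ∩ V`: since `G`
contains the base measure, the affine span of its image is a linear subspace. -/
lemma exists_logMap_image_subset_spanV (hW : m ∈ W2 Ω)
    (hm : StrictMonoOn (quantile m) (Ioo 0 1)) {U : Fin K → Lp ℝ 2 m} (hU : Orthonormal ℝ U)
    {G : Set (Measure ℝ)} (hG : G ∈ CG Ω m K) :
    ∃ U' : Fin K → Lp ℝ 2 m, Orthonormal ℝ U' ∧ logMap m '' G ⊆ spanV Ω m U' := by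
  obtain ⟨hsub, -, -, hmem, -, hdim⟩ := hG
  obtain ⟨U', hU', hle⟩ := exists_orthonormal_le_span hU _ hdim
  refine ⟨U', hU', ?_⟩
  rintro _ ⟨ν, hν, rfl⟩
  refine ⟨hle ?_, ν, hsub hν, rfl⟩
  rw [direction_affineSpan]
  have := vsub_mem_vectorSpan ℝ (mem_image_of_mem (logMap m) hν) (mem_image_of_mem (logMap m) hmem)
  rwa [logMap_self hW hm, vsub_eq_sub, sub_zero] at this

lemma objective_eq (hΩ : Ω.OrdConnected) (hW : m ∈ W2 Ω)
    (hm : StrictMonoOn (quantile m) (Ioo 0 1)) {n : ℕ} (ν : Fin n → Measure ℝ)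
    (U : Fin K → Lp ℝ 2 m) :
    objective Ω ν m U =
      (1 / (n : ℝ)) * ∑ i, Metric.infDist (logMap m (ν i)) (spanV Ω m U) ^ 2 := by
  simp only [objective,
    norm_sub_proj ⟨0, zero_mem_spanV hW hm U⟩ (convex_spanV hΩ hW hm U)]

lemma DW_eq (hW : m ∈ W2 Ω) (hm : StrictMonoOn (quantile m) (Ioo 0 1)) {n : ℕ}
    {ν : Fin n → Measure ℝ} (hν : ∀ i, ν i ∈ W2 Ω) {G : Set (Measure ℝ)} (hG : G ⊆ W2 Ω) :
    DW ν G = (1 / (n : ℝ)) * ∑ i, Metric.infDist (logMap m (ν i)) (logMap m '' G) ^ 2 := by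
  simp only [DW, fun i => dWSet_eq_infDist hW hm (hν i) hG]

end PGS

end WassersteinGPCA

end

open WassersteinGPCA in
theorem proposition2p2 (Ω : Set ℝ) (hΩ : Ω.OrdConnected) (n K : ℕ) (hn : 1 ≤ n) (hK : 1 ≤ K)
    (ν : Fin n → MeasureTheory.Measure ℝ) (hν : ∀ i, ν i ∈ WassersteinGPCA.W2ac Ω)
    (νbar : MeasureTheory.Measure ℝ) (hbar : WassersteinGPCA.IsBarycenter Ω ν νbar)
    (U : Fin K → MeasureTheory.Lp ℝ 2 νbar) (hU : Orthonormal ℝ U)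
    (hmin : IsMinOn (WassersteinGPCA.objective Ω ν νbar)
      {U' : Fin K → MeasureTheory.Lp ℝ 2 νbar | Orthonormal ℝ U'} U) :
    WassersteinGPCA.IsPGS Ω ν νbar K
      (WassersteinGPCA.expMap νbar '' WassersteinGPCA.spanV Ω νbar U) := by
  have hm := strictMonoOn_quantile_barycenter hΩ hn hν hbar
  have hW := hbar.1
  have hν' := fun i => (hν i).1
  refine ⟨image_expMap_spanV_mem_CG hΩ hW hm U, fun G hG => ?_⟩
  obtain ⟨U', hU', hsub⟩ := exists_logMap_image_subset_spanV hW hm hU hG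
  calc DW ν (expMap νbar '' spanV Ω νbar U)
      = objective Ω ν νbar U := by
        rw [DW_eq hW hm hν' (image_expMap_spanV_subset hW hm U),
          logMap_image_expMap_spanV hW hm U, objective_eq hΩ hW hm]
    _ ≤ objective Ω ν νbar U' := hmin hU'
    _ ≤ DW ν G := by
        rw [DW_eq hW hm hν' hG.1, objective_eq hΩ hW hm]
        gcongr with i
        · exact Metric.infDist_nonneg
        · exact Metric.infDist_le_infDist_of_subset hsub (hG.2.1.image _)
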